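/- **Conventions.** A partial combinatory algebra (pca) on a set $A$ is a partial map $A\times A\to A$, $(a,b)\mapsto ab$ (associating to the left), with elements $\mathsf k,\mathsf s\in A$ such that for all $a,b,c\in A$: $\mathsf sab$ is defined, $\mathsf kab=a$, and $\mathsf sabc\lesssim ac(bc)$; here $t\lesssim s$ means that if $s$ is defined, then $t$ is defined and has the same value. Put $\mathsf T=\mathsf k$, $\mathsf F=\mathsf k(\mathsf{skk})$, $\mathsf pab=\mathsf s(\mathsf s(\mathsf{skk})(\mathsf ka))(\mathsf kb)$, and code finite tuples by $[\,]=\mathsf p\mathsf T\mathsf T$, $[u_0,\dots,u_n]=\mathsf p\mathsf F(\mathsf pu_0[u_1,\dots,u_n])$. For subsets $P,Q$, $PQ\downarrow$ means that $pq$ is defined for all $p\in P$, $q\in Q$, and then $PQ=\{pq\mid p\in P,q\in Q\}$; an inclusion or equality about $PQ$ includes the claim $PQ\downarrow$, and $aP$ means $\{a\}P$. An applicative morphism $\gamma:A\to B$ of pcas is a relation assigning to each $a\in A$ a nonempty set $\gamma(a)\subseteq B$, for which there is $r\in B$ such that $r\gamma(a)\gamma(a')\subseteq\gamma(aa')$ whenever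 $aa'$ is defined. It is decidable if some $d\in B$ satisfies $d\gamma(\mathsf T_A)=\{\mathsf T_B\}$ and $d\gamma(\mathsf F_A)=\{\mathsf F_B\}$. Morphisms are composed as relations. For $\gamma,\delta:A\to B$, $\gamma\preceq\delta$ means that some $t\in B$ satisfies $t\gamma(a)\subseteq\delta(a)$ for all $a\in A$; $\gamma\cong\delta$ (equivalence) means $\gamma\preceq\delta$ and $\delta\preceq\gamma$. For a partial function $g:A\to A$ let $I_1^A(g)=\{a\in A\mid\forall b\; ab\lesssim g(b)\}$, and let $\mathrm{Tot}_A$ be the set of total $g:A\to A$ with $I_1^A(g)\ne\emptyset$. For $\gamma:A\to B$ let $I_1^\gamma(g)=\{b\in B\mid \forall a\;(g(a)\text{ defined}\Rightarrow b\gamma(a)\subseteq\gamma(g(a)))\}$, and let $\mathrm{Tot}_\gamma$ be the set of total $g:A\to A$ with $I_1^\gamma(g)\neq\emptyset$. The set $E_A$ of effective operations in $A$ consists of the partial functionals $F:A^A\to A$ for which there is $a\in A$ with $aI_1^A(g)=\{F(g)\}$ for all $g\in\mathrm{Tot}_A$ with $F(g)$ defined. The set $E_\gamma$ consists of those for which there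 is $b\in B$ with $bI_1^\gamma(g)\subseteq\gamma(F(g))$ for all $g\in\mathrm{Tot}_\gamma$ with $F(g)$ defined. For a partial function $f:A\to A$, let $A[f]$ be the set $A$ with the partial application $\cdot^f$ given by: $a\cdot^fb=c$ iff there is a (possibly empty) tuple $u_0,\dots,u_{n-1}$ in $A$ such that $a[b,u_0,\dots,u_{n-1}]=\mathsf p\mathsf Tc$ and for every $i<n$ there is $v_i$ with $a[b,u_0,\dots,u_{i-1}]=\mathsf p\mathsf Fv_i$ and $f(v_i)=u_i$. (Such a $c$ is unique, and $\mathrm{Tot}$, $I_1$ make sense for any partial application.) **Theorem.** Let $A$ be a pca and $F:A^A\to A$ a partial functional. Define partial functions $f_\alpha:A\to A$ by transfinite recursion: $f_0=\emptyset$; $f_{\alpha+1}(a)=b$ iff there is $g\in\mathrm{Tot}_{A[f_\alpha]}$ with $a\in I_1^{A[f_\alpha]}(g)$ and $F(g)=b$; $f_\lambda=\bigcup_{\alpha<\lambda}f_\alpha$ for limit ordinals $\lambda>0$. Then $f_\alpha\subseteq f_\beta$ for all ordinals $\alpha\le\beta$, so $f=\bigcup_\alpha f_\alpha$ is a partial function.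 Moreover $A[F]:=A[f]$ is a pca on the set $A$, the identity relation on $A$ is a decidable applicative morphism $\iota_F:A\to A[F]$, and: 1. $F\in E_{A[F]}=E_{\iota_F}$. 2. Whenever $B$ is a pca and $\gamma:A\to B$ is a decidable applicative morphism with $F\in E_\gamma$, there is a decidable applicative morphism $\gamma_F:A[F]\to B$, unique up to equivalence, such that $\gamma_F\circ\iota_F=\gamma$. Moreover, if $\delta:A[F]\to B$ is a decidable applicative morphism with $\delta\circ\iota_F\cong\gamma$, then $\delta\cong\gamma_F$. -/

import Mathlib

universe u v w

/-- A partial applicative structure on `A`: a partial map `A × A → A`, `(a, b) ↦ ab`. -/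
abbrev PAS (A : Type u) : Type u := A → A → Part A

namespace PAS

variable {A : Type u}

/-- Application of terms: `ts` denotes iff `t`, `s` denote and the application of their values is
defined. -/
def ap (m : PAS A) (t s : Part A) : Part A := t.bind fun a => s.bind fun b => m a b

/-- `PQ↓` for subsets `P, Q`. -/
def SetDefined (m : PAS A) (P Q : Set A) : Prop := ∀ p ∈ P, ∀ q ∈ Q, (m p q).Dom

/-- `PQ = {pq | p ∈ P, q ∈ Q}` (meant to be used together with `PQ↓`). -/
def setApp (m : PAS A) (P Q : Set A) : Set A := {c | ∃ p ∈ P, ∃ q ∈ Q, c ∈ m p q}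

end PAS

/-- `t ≲ s`: if `s` denotes, then `t` denotes and has the same value. -/
def Lesssim {A : Type u} (t s : Part A) : Prop := ∀ c ∈ s, c ∈ t

/-- A partial combinatory algebra on the set `A`. -/
structure PCA (A : Type u) where
  app : PAS A
  k : A
  s : A
  s_def : ∀ a b, (app.ap (app s a) (Part.some b)).Dom
  k_eq : ∀ a b, app.ap (app k a) (Part.some b) = Part.some a
  s_app : ∀ a b c, Lesssim (app.ap (app.ap (app s a) (Part.some b)) (Part.some c))
    (app.ap (app a c) (app b c))

namespace PCA

variable {A : Type u} (M : PCA A)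

theorem k_dom (a : A) : (M.app M.k a).Dom := by
  have h : a ∈ M.app.ap (M.app M.k a) (Part.some a) := by rw [M.k_eq]; exact Part.mem_some a
  obtain ⟨x, hx, -⟩ := Part.mem_bind_iff.1 h
  exact Part.dom_iff_mem.2 ⟨x, hx⟩

/-- The element `ka`. -/
def K (a : A) : A := (M.app M.k a).get (M.k_dom a)

/-- The element `sab`. -/
def S (a b : A) : A := (M.app.ap (M.app M.s a) (Part.some b)).get (M.s_def a b)

/-- The identity combinator `skk`. -/
def I : A := M.S M.k M.k

/-- The boolean `T = k`, with `Tab = a`. -/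
def T : A := M.k

/-- The boolean `F = k(skk)`, with `Fab = b`. -/
def F : A := M.K M.I

/-- The pair `pab = s(s(skk)(ka))(kb)`; it satisfies `(pab)z ≲ zab`. -/
def pair (a b : A) : A := M.S (M.S M.I (M.K a)) (M.K b)

/-- The coding `[u₀, …, uₙ]` of finite tuples: `[] = pTT` and `[a] * u = pF(pau)`. -/
def tuple : List A → A
  | [] => M.pair M.T M.T
  | a :: u => M.pair M.F (M.pair a (tuple u))

/-- `u` is an `f`-dialogue between `a` and `b`: for every `i` below the length of `u` there is `vᵢ`
with `a([b] * [u₀, …, uᵢ₋₁]) = pFvᵢ` and `f(vᵢ) = uᵢ`. -/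
def IsDialogue (f : A →. A) (a b : A) (u : List A) : Prop :=
  ∀ (i : ℕ) (hi : i < u.length), ∃ v : A,
    M.pair M.F v ∈ M.app a (M.tuple (b :: u.take i)) ∧ u[i] ∈ f v

/-- Some `f`-dialogue `u` between `a` and `b` halts with value `c`, i.e. `a([b] * u) = pTc`. -/
def HaltsWith (f : A →. A) (a b c : A) : Prop :=
  ∃ u : List A, M.IsDialogue f a b u ∧ M.pair M.T c ∈ M.app a (M.tuple (b :: u))

/-- The application `a ·ᶠ b` of `A[f]`. The value is unique, see `mem_oracleApp`. -/
noncomputable def oracleApp (f : A →. A) : PAS A := fun a b =>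
  ⟨∃ c, M.HaltsWith f a b c, fun h => h.choose⟩

end PCA

namespace PAS

variable {A : Type u}

/-- `I₁(f)`: the set of indices of the partial function `f`. -/
def I₁ (m : PAS A) (f : A →. A) : Set A := {a | ∀ b, Lesssim (m a b) (f b)}

/-- `PR`: the partial functions that have an index. -/
def PR (m : PAS A) : Set (A →. A) := {f | ∃ a, ∀ b, Lesssim (m a b) (f b)}

/-- `Tot`: the total functions in `PR`. -/
def Tot (m : PAS A) : Set (A → A) := {g | (g : A →. A) ∈ m.PR}

/-- `E`: the (partial) functionals that are effective operations. -/
def E (m : PAS A) : Set ((A → A) →. A) :=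
  {Φ | ∃ a, ∀ g ∈ m.Tot, ∀ y ∈ Φ g,
    m.SetDefined {a} (m.I₁ g) ∧ m.setApp {a} (m.I₁ g) = {y}}

end PAS

/-- An applicative morphism: a total relation `a ↦ γ(a) ⊆ B` that has a realizer. -/
@[ext]
structure ApplicativeMorphism {A : Type u} {B : Type v} (M : PCA A) (N : PCA B) where
  rel : A → Set B
  total : ∀ a, (rel a).Nonempty
  realized : ∃ r : B, ∀ a a' c, c ∈ M.app a a' →
    N.app.SetDefined {r} (rel a) ∧
    N.app.SetDefined (N.app.setApp {r} (rel a)) (rel a') ∧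
    N.app.setApp (N.app.setApp {r} (rel a)) (rel a') ⊆ rel c

namespace PCA

variable {A : Type u} (M : PCA A)

theorem K_mem (a : A) : M.K a ∈ M.app M.k a := Part.get_mem _

theorem K_app (a b : A) : a ∈ M.app (M.K a) b := by
  have h : a ∈ M.app.ap (M.app M.k a) (Part.some b) := by rw [M.k_eq]; exact Part.mem_some a
  obtain ⟨x, hx, h⟩ := Part.mem_bind_iff.1 h
  obtain rfl := Part.mem_unique hx (M.K_mem a)
  simpa using h

theorem S_app {a b c x y z : A} (hx : x ∈ M.app a c) (hy : y ∈ M.app b c) (hz : z ∈ M.app x y) :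
    z ∈ M.app (M.S a b) c := by
  have h := M.s_app a b c z
    (Part.mem_bind_iff.2 ⟨x, hx, Part.mem_bind_iff.2 ⟨y, hy, hz⟩⟩)
  obtain ⟨t, ht, h⟩ := Part.mem_bind_iff.1 h
  obtain rfl := Part.mem_unique ht (Part.get_mem (M.s_def a b))
  simp only [Part.bind_some] at h
  exact h

theorem I_app (a : A) : a ∈ M.app M.I a := M.S_app (M.K_mem a) (M.K_mem a) (M.K_app a _)

theorem pair_app {a b x y z : A} (hx : x ∈ M.app z a) (hy : y ∈ M.app x b) :
    y ∈ M.app (M.pair a b) z :=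
  M.S_app (M.S_app (M.I_app z) (M.K_app a z) hx) (M.K_app b z) hy

theorem pair_inj {a b a' b' : A} (h : M.pair a b = M.pair a' b') : a = a' ∧ b = b' := by
  constructor
  · have h1 := M.pair_app (M.K_mem a) (M.K_app a b)
    have h2 := M.pair_app (M.K_mem a') (M.K_app a' b')
    rw [h] at h1
    exact Part.mem_unique h1 h2
  · have h1 := M.pair_app (M.K_app M.I a) (M.I_app b)
    have h2 := M.pair_app (M.K_app M.I a') (M.I_app b')
    rw [h] at h1
    exact Part.mem_unique h1 h2

theorem eq_of_T_eq_F (h : M.T = M.F) (a b : A) : a = b := by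
  have h1 : M.K a ∈ M.app M.T a := M.K_mem a
  have h2 : M.I ∈ M.app M.F a := M.K_app M.I a
  rw [h] at h1
  have h3 := M.K_app a b
  rw [Part.mem_unique h1 h2] at h3
  exact Part.mem_unique h3 (M.I_app b)

theorem haltsWith_unique {f : A →. A} {a b c c' : A} (h : M.HaltsWith f a b c)
    (h' : M.HaltsWith f a b c') : c = c' := by
  by_cases hTF : M.T = M.F
  · exact M.eq_of_T_eq_F hTF c c'
  obtain ⟨u, hu, hc⟩ := h
  obtain ⟨u', hu', hc'⟩ := h'
  have key : ∀ i, i ≤ u.length → i ≤ u'.length → u.take i = u'.take i := by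
    intro i
    induction i with
    | zero => simp
    | succ i ih =>
      intro h1 h2
      have e := ih (by omega) (by omega)
      obtain ⟨v, hv, hfv⟩ := hu i (by omega)
      obtain ⟨v', hv', hfv'⟩ := hu' i (by omega)
      rw [e] at hv
      obtain rfl := (M.pair_inj (Part.mem_unique hv hv')).2
      rw [List.take_succ_eq_append_getElem (by omega), List.take_succ_eq_append_getElem (by omega),
        e, Part.mem_unique hfv hfv']
  rcases lt_trichotomy u.length u'.length with hl | hl | hl
  · obtain ⟨v, hv, -⟩ := hu' _ hl
    rw [← key _ le_rfl hl.le, List.take_length] at hv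
    exact absurd (M.pair_inj (Part.mem_unique hc hv)).1 hTF
  · have e := key _ le_rfl hl.le
    rw [List.take_length, hl, List.take_length] at e
    subst e
    exact (M.pair_inj (Part.mem_unique hc hc')).2
  · obtain ⟨v, hv, -⟩ := hu _ hl
    rw [key _ hl.le le_rfl, List.take_length] at hv
    exact absurd (M.pair_inj (Part.mem_unique hc' hv)).1 hTF

theorem mem_oracleApp {f : A →. A} {a b c : A} :
    c ∈ M.oracleApp f a b ↔ M.HaltsWith f a b c := by
  constructor
  · rintro ⟨h, rfl⟩
    exact h.choose_spec
  · intro h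
    exact ⟨⟨c, h⟩, M.haltsWith_unique (Exists.choose_spec (⟨c, h⟩ : ∃ c, M.HaltsWith f a b c)) h⟩

/-- The partial function with graph `R`, for a single-valued relation `R`. -/
noncomputable def ofGraph (R : A → A → Prop) : A →. A := fun a =>
  ⟨∃ b, R a b, fun h => h.choose⟩

/-- The partial functions `f_α`, by transfinite recursion:
* `f_0 = ∅`;
* `f_{α+1}(a) = b` iff there is `g ∈ Tot_{A[f_α]}` with `a ∈ I₁^{A[f_α]}(g)` and `Φ(g) = b`;
* `f_λ = ⋃_{α < λ} f_α` for a limit ordinal `λ`. -/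
noncomputable def stage (Φ : (A → A) →. A) (α : Ordinal.{u}) : A →. A :=
  Ordinal.limitRecOn α
    (fun _ => Part.none)
    (fun _ f => ofGraph fun a b =>
      ∃ g ∈ (M.oracleApp f).Tot, a ∈ (M.oracleApp f).I₁ g ∧ b ∈ Φ g)
    (fun l _ f => ofGraph fun a b => ∃ (β : Ordinal.{u}) (hβ : β < l), b ∈ f β hβ a)

/-- `f = ⋃_α f_α`, the union over all ordinals. -/
noncomputable def stageUnion (Φ : (A → A) →. A) : A →. A :=
  ofGraph fun a b => ∃ α : Ordinal.{u}, b ∈ M.stage Φ α a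

end PCA

namespace ApplicativeMorphism

variable {A : Type u} {B : Type v} {C : Type w} {M : PCA A} {N : PCA B} {P : PCA C}

/-- Composition `δ ∘ γ` of applicative morphisms: composition of the relations. -/
def comp (δ : ApplicativeMorphism N P) (γ : ApplicativeMorphism M N) :
    ApplicativeMorphism M P where
  rel a := {c | ∃ b ∈ γ.rel a, c ∈ δ.rel b}
  total a := by
    obtain ⟨b, hb⟩ := γ.total a
    obtain ⟨c, hc⟩ := δ.total b
    exact ⟨c, b, hb, hc⟩
  realized := by
    obtain ⟨r, hr⟩ := γ.realized
    obtain ⟨q, hq⟩ := δ.realized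
    obtain ⟨ρ, hρ⟩ := δ.total r
    have hq' : ∀ {b b' d x y}, d ∈ N.app b b' → x ∈ δ.rel b → y ∈ δ.rel b' →
        ∃ z, z ∈ P.app q x ∧ ∃ t ∈ P.app z y, t ∈ δ.rel d := by
      intro b b' d x y hd hx hy
      obtain ⟨h1, h2, h3⟩ := hq b b' d hd
      have hz := Part.get_mem (h1 q rfl x hx)
      have hzm : (P.app q x).get (h1 q rfl x hx) ∈ P.app.setApp {q} (δ.rel b) :=
        ⟨q, rfl, x, hx, hz⟩
      have ht := Part.get_mem (h2 _ hzm y hy)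
      exact ⟨_, hz, _, ht, h3 ⟨_, hzm, y, hy, ht⟩⟩
    have hr' : ∀ {a a' d x y}, d ∈ M.app a a' → x ∈ γ.rel a → y ∈ γ.rel a' →
        ∃ z, z ∈ N.app r x ∧ ∃ t ∈ N.app z y, t ∈ γ.rel d := by
      intro b b' d x y hd hx hy
      obtain ⟨h1, h2, h3⟩ := hr b b' d hd
      have hz := Part.get_mem (h1 r rfl x hx)
      have hzm : (N.app r x).get (h1 r rfl x hx) ∈ N.app.setApp {r} (γ.rel b) :=
        ⟨r, rfl, x, hx, hz⟩
      have ht := Part.get_mem (h2 _ hzm y hy)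
      exact ⟨_, hz, _, ht, h3 ⟨_, hzm, y, hy, ht⟩⟩
    obtain ⟨g, hg⟩ : ∃ g, g ∈ P.app q ρ := by
      obtain ⟨x, hx⟩ := γ.total M.k
      obtain ⟨z, hz, -⟩ := hr' (M.K_mem M.k) hx hx
      obtain ⟨y, hy⟩ := δ.total x
      obtain ⟨g, hg, -⟩ := hq' hz hρ hy
      exact ⟨g, hg⟩
    have key : ∀ {a a' d x y}, d ∈ M.app a a' → (∃ b ∈ γ.rel a, x ∈ δ.rel b) →
        (∃ b ∈ γ.rel a', y ∈ δ.rel b) →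
        ∃ z, z ∈ P.app (P.S (P.K q) g) x ∧ ∃ t ∈ P.app z y, ∃ b ∈ γ.rel d, t ∈ δ.rel b := by
      rintro a a' d x y hd ⟨b, hb, hx⟩ ⟨b', hb', hy⟩
      obtain ⟨z, hz, t, ht, htd⟩ := hr' hd hb hb'
      obtain ⟨g', hg', z', hz', hz'm⟩ := hq' hz hρ hx
      obtain rfl := Part.mem_unique hg hg'
      obtain ⟨w, hw, t', ht', ht'm⟩ := hq' ht hz'm hy
      exact ⟨w, P.S_app (P.K_app q x) hz' hw, t', ht', t, htd, ht'm⟩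
    refine ⟨P.S (P.K q) g, fun a a' d hd => ⟨?_, ?_, ?_⟩⟩
    · rintro _ rfl x hx
      obtain ⟨b', hb'⟩ := γ.total a'
      obtain ⟨y, hy⟩ := δ.total b'
      obtain ⟨z, hz, -⟩ := key hd hx ⟨b', hb', hy⟩
      exact Part.dom_iff_mem.2 ⟨z, hz⟩
    · rintro z ⟨_, rfl, x, hx, hz⟩ y hy
      obtain ⟨z', hz', t, ht, -⟩ := key hd hx hy
      obtain rfl := Part.mem_unique hz hz'
      exact Part.dom_iff_mem.2 ⟨t, ht⟩
    · rintro t ⟨z, ⟨_, rfl, x, hx, hz⟩, y, hy, ht⟩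
      obtain ⟨z', hz', t', ht', h⟩ := key hd hx hy
      obtain rfl := Part.mem_unique hz hz'
      obtain rfl := Part.mem_unique ht ht'
      exact h

/-- `γ` is decidable: it has a decider. -/
def IsDecidable (γ : ApplicativeMorphism M N) : Prop :=
  ∃ d : B,
    (N.app.SetDefined {d} (γ.rel M.T) ∧ N.app.setApp {d} (γ.rel M.T) = {N.T}) ∧
    (N.app.SetDefined {d} (γ.rel M.F) ∧ N.app.setApp {d} (γ.rel M.F) = {N.F})

/-- The preorder `γ ⪯ δ`. -/
def Le (γ δ : ApplicativeMorphism M N) : Prop :=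
  ∃ t : B, ∀ a, N.app.SetDefined {t} (γ.rel a) ∧ N.app.setApp {t} (γ.rel a) ⊆ δ.rel a

/-- Equivalence of applicative morphisms. -/
def Equivalent (γ δ : ApplicativeMorphism M N) : Prop := γ.Le δ ∧ δ.Le γ

/-- `I₁^γ(f)`. -/
def I₁ (γ : ApplicativeMorphism M N) (f : A →. A) : Set B :=
  {b | ∀ a, ∀ c ∈ f a, N.app.SetDefined {b} (γ.rel a) ∧ N.app.setApp {b} (γ.rel a) ⊆ γ.rel c}

/-- `PR_γ`. -/
def PR (γ : ApplicativeMorphism M N) : Set (A →. A) :=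
  {f | ∃ b : B, ∀ a, ∀ c ∈ f a,
    N.app.SetDefined {b} (γ.rel a) ∧ N.app.setApp {b} (γ.rel a) ⊆ γ.rel c}

/-- `Tot_γ`: the total functions in `PR_γ`. -/
def Tot (γ : ApplicativeMorphism M N) : Set (A → A) := {g | (g : A →. A) ∈ γ.PR}

/-- `E_γ`: the effective operations relative to `γ`. -/
def E (γ : ApplicativeMorphism M N) : Set ((A → A) →. A) :=
  {Φ | ∃ b : B, ∀ g ∈ γ.Tot, ∀ y ∈ Φ g,
    N.app.SetDefined {b} (γ.I₁ g) ∧ N.app.setApp {b} (γ.I₁ g) ⊆ γ.rel y}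

end ApplicativeMorphism

/-! The proof uses combinatory completeness and the recursion theorem to program with dialogues. A
computation in $A[f]$ is a well-founded dialogue (`Halts`), and dialogues can be concatenated inside
$A$ (`exists_run`, `halts_of_run`). Running $a$ on $c$, then $b$ on $c$, then the first result on
the second gives the combinator $\mathsf s$ of $A[f]$. The strategy that asks its argument and
returns the answer is an index of $f$ in $A[f]$.

The operator $f_\alpha\mapsto f_{\alpha+1}$ is monotone, because a larger oracle only extends the
application of $A[f]$. As $A\times A$ is a set, the stages become stationary, so the union $f$ is
closed under the operator (`mem_stageUnion_of_stageRel`): if $e$ is an index of $g$ in $A[f]$ and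
$F(g)$ is defined, then $f(e)=F(g)$. The index of $f$ therefore makes $F$ effective in $A[f]$.

For the universal property, $\gamma_F$ is $\gamma$ itself as a relation, and only a realizer for the
application of $A[f]$ has to be found. A decidable $\gamma$ lets $B$ follow a dialogue once some
$e\in B$ represents the oracle (`exists_loop`). Conversely, simulating $v$ with $e$ yields an
element of $I_1^\gamma(g)$, to which the realizer of $F\in E_\gamma$ applies. The recursion theorem
in $B$ closes this circle, and induction on $\alpha$ shows that the resulting $e$ represents every
$f_\alpha$ (`exists_realizer_stageUnion`). Uniqueness is immediate, since $\delta\circ\iota_F$ and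
$\delta$ are the same relation. -/

/-! ### Combinatory completeness and the recursion theorem. -/

/-- Terms over `A`, with variables named by natural numbers. -/
inductive CTerm (A : Type u) : Type u
  | var (n : ℕ) : CTerm A
  | const (a : A) : CTerm A
  | app (t s : CTerm A) : CTerm A

namespace PCA

variable {A : Type u} (M : PCA A)

@[simp] theorem app_k (a : A) : M.app M.k a = Part.some (M.K a) := Part.eq_some_iff.2 (M.K_mem a)

@[simp] theorem app_K (a b : A) : M.app (M.K a) b = Part.some a := Part.eq_some_iff.2 (M.K_app a b)

@[simp] theorem app_I (a : A) : M.app M.I a = Part.some a := Part.eq_some_iff.2 (M.I_app a)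

@[simp] theorem app_F (a : A) : M.app M.F a = Part.some M.I := M.app_K M.I a

@[simp] theorem app_pair_T (a b : A) : M.app (M.pair a b) M.T = Part.some a :=
  Part.eq_some_iff.2 (M.pair_app (M.K_mem a) (M.K_app a b))

@[simp] theorem app_pair_F (a b : A) : M.app (M.pair a b) M.F = Part.some b :=
  Part.eq_some_iff.2 (M.pair_app (M.K_app M.I a) (M.I_app b))

theorem exists_app_s (a b : A) : ∃ x ∈ M.app M.s a, M.S a b ∈ M.app x b := by
  simpa [PAS.ap, S] using Part.get_mem (M.s_def a b)

/-- The value of a term under the assignment `ρ`. -/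
def eval (ρ : ℕ → A) : CTerm A → Part A
  | .var n => Part.some (ρ n)
  | .const a => Part.some a
  | .app t s => M.app.ap (eval ρ t) (eval ρ s)

variable {M}

@[simp] theorem eval_var (ρ : ℕ → A) (n : ℕ) : M.eval ρ (.var n) = Part.some (ρ n) := rfl

@[simp] theorem eval_const (ρ : ℕ → A) (a : A) : M.eval ρ (.const a) = Part.some a := rfl

@[simp] theorem mem_eval_app {ρ : ℕ → A} {t s : CTerm A} {c : A} :
    c ∈ M.eval ρ (.app t s) ↔ ∃ a ∈ M.eval ρ t, ∃ b ∈ M.eval ρ s, c ∈ M.app a b := by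
  simp [eval, PAS.ap]

variable (M)

/-- Bracket abstraction `λn.t`. -/
def lam (n : ℕ) : CTerm A → CTerm A
  | .var m => if m = n then .const M.I else .app (.const M.k) (.var m)
  | .const a => .const (M.K a)
  | .app t s => .app (.app (.const M.s) (lam n t)) (lam n s)

/-- The element of `A` denoted by `λn.t` under the assignment `ρ`. -/
def clo (n : ℕ) (ρ : ℕ → A) : CTerm A → A
  | .var m => if m = n then M.I else M.K (ρ m)
  | .const a => M.K a
  | .app t s => M.S (clo n ρ t) (clo n ρ s)

@[simp] theorem eval_lam (n : ℕ) (ρ : ℕ → A) (t : CTerm A) :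
    M.eval ρ (M.lam n t) = Part.some (M.clo n ρ t) := by
  rw [Part.eq_some_iff]
  induction t with
  | var m => by_cases h : m = n <;> simp [lam, clo, h]
  | const a => simp [lam, clo]
  | app t s iht ihs =>
    obtain ⟨x, hx, h⟩ := M.exists_app_s (M.clo n ρ t) (M.clo n ρ s)
    simp only [lam, mem_eval_app, clo]
    exact ⟨x, ⟨_, Part.mem_some _, _, iht, hx⟩, _, ihs, h⟩

variable {M}

theorem mem_app_clo {n : ℕ} {ρ : ℕ → A} {t : CTerm A} {x c : A}
    (h : c ∈ M.eval (Function.update ρ n x) t) : c ∈ M.app (M.clo n ρ t) x := by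
  induction t generalizing c with
  | var m =>
    by_cases hm : m = n
    · subst hm; simpa [clo] using h
    · simpa [clo, hm] using h
  | const a => simpa [clo] using h
  | app t s iht ihs =>
    obtain ⟨a, ha, b, hb, hc⟩ := mem_eval_app.1 h
    exact M.S_app (iht ha) (ihs hb) hc

@[simp] theorem app_clo_lam (n m : ℕ) (ρ : ℕ → A) (t : CTerm A) (x : A) :
    M.app (M.clo n ρ (M.lam m t)) x = Part.some (M.clo m (Function.update ρ n x) t) :=
  Part.eq_some_iff.2 (mem_app_clo (by simp))

variable (M)

/-- The term `p t s`. -/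
def pairT (t s : CTerm A) : CTerm A :=
  .app (.app (.const M.s) (.app (.app (.const M.s) (.const M.I)) (.app (.const M.k) t)))
    (.app (.const M.k) s)

/-- The term that applies `f` to `x` if `m = pTx`, and `g` to `x` if `m = pFx`. -/
def caseT (m f g : CTerm A) : CTerm A :=
  .app (.app (.app (.app m (.const M.T)) f) g) (.app m (.const M.F))

variable {M}

theorem mem_eval_pairT {ρ : ℕ → A} {t s : CTerm A} {x y : A} (hx : x ∈ M.eval ρ t)
    (hy : y ∈ M.eval ρ s) : M.pair x y ∈ M.eval ρ (M.pairT t s) := by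
  obtain ⟨a, ha, h⟩ := M.exists_app_s M.I (M.K x)
  obtain ⟨b, hb, h'⟩ := M.exists_app_s (M.S M.I (M.K x)) (M.K y)
  simp only [pairT, mem_eval_app]
  exact ⟨b, ⟨_, Part.mem_some _, _, ⟨a, ⟨_, Part.mem_some _, _, Part.mem_some _, ha⟩, _,
    ⟨_, Part.mem_some _, _, hx, M.K_mem x⟩, h⟩, hb⟩, _, ⟨_, Part.mem_some _, _, hy, M.K_mem y⟩, h'⟩

@[simp] theorem mem_eval_pairT_iff {ρ : ℕ → A} {t s : CTerm A} {c : A} :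
    c ∈ M.eval ρ (M.pairT t s) ↔ ∃ x ∈ M.eval ρ t, ∃ y ∈ M.eval ρ s, c = M.pair x y := by
  constructor
  · intro h
    have h' := h
    simp only [pairT, mem_eval_app] at h'
    obtain ⟨-, ⟨-, -, -, ⟨-, -, -, ⟨-, -, x, hx, -⟩, -⟩, -⟩, -, ⟨-, -, y, hy, -⟩, -⟩ := h'
    exact ⟨x, hx, y, hy, Part.mem_unique h (mem_eval_pairT hx hy)⟩
  · rintro ⟨x, hx, y, hy, rfl⟩
    exact mem_eval_pairT hx hy

/-- Application is strict, so both branches must denote. They are abstractions for this reason: the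
branch not taken may then have an undefined body. -/
theorem mem_eval_caseT_T {ρ : ℕ → A} {n n' : ℕ} {m f g : CTerm A} {x c : A}
    (hm : M.pair M.T x ∈ M.eval ρ m) (hc : c ∈ M.eval (Function.update ρ n x) f) :
    c ∈ M.eval ρ (M.caseT m (M.lam n f) (M.lam n' g)) := by
  simp only [caseT, mem_eval_app, eval_lam]
  exact ⟨M.clo n ρ f, ⟨_, ⟨M.T, ⟨_, hm, M.T, by simp, by simp⟩, _, Part.mem_some _, M.K_mem _⟩, _,
    Part.mem_some _, by simp⟩, x, ⟨_, hm, M.F, by simp, by simp⟩, mem_app_clo hc⟩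

theorem mem_eval_caseT_F {ρ : ℕ → A} {n n' : ℕ} {m f g : CTerm A} {x c : A}
    (hm : M.pair M.F x ∈ M.eval ρ m) (hc : c ∈ M.eval (Function.update ρ n' x) g) :
    c ∈ M.eval ρ (M.caseT m (M.lam n f) (M.lam n' g)) := by
  simp only [caseT, mem_eval_app, eval_lam]
  exact ⟨M.clo n' ρ g, ⟨M.I, ⟨M.F, ⟨_, hm, M.T, by simp, by simp⟩, _, Part.mem_some _, by simp⟩, _,
    Part.mem_some _, by simp⟩, x, ⟨_, hm, M.F, by simp, by simp⟩, mem_app_clo hc⟩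

variable (M)

/-- The recursion theorem. -/
theorem exists_fix (g : A) : ∃ e : A, ∀ h ∈ M.app g e, ∀ x, ∀ c ∈ M.app h x, c ∈ M.app e x := by
  -- With $W=\lambda xy.\,g(xx)y$, the fixed point is $e=WW$. The abstraction over $y$ makes $e$
  -- exist even where $ge$ is undefined.
  let t : CTerm A := .app (.app (.const g) (.app (.var 0) (.var 0))) (.var 1)
  let W := M.clo 0 (fun _ => g) (M.lam 1 t)
  refine ⟨M.clo 1 (Function.update (fun _ => g) 0 W) t, fun h hh x c hc => mem_app_clo ?_⟩
  simp only [t, mem_eval_app, eval_const, eval_var, Part.mem_some_iff, exists_eq_left]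
  refine ⟨h, ⟨_, ?_, hh⟩, by simpa using hc⟩
  simp [W, t]

/-- The recursion theorem for terms: variable `i` stands for the element being defined and `j` for
its argument. -/
theorem exists_fix_eval (i j : ℕ) (ρ : ℕ → A) (t : CTerm A) : ∃ e : A, ∀ x,
    ∀ c ∈ M.eval (Function.update (Function.update ρ i e) j x) t, c ∈ M.app e x := by
  obtain ⟨e, he⟩ := M.exists_fix (M.clo i ρ (M.lam j t))
  exact ⟨e, fun x c hc => he _ (by rw [app_clo_lam]; exact Part.mem_some _) x c (mem_app_clo hc)⟩

end PCA

/-! ### Dialogues and their simulation inside $A$. -/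

namespace PCA

variable {A : Type u} (M : PCA A)

/-- The `f`-dialogue with the strategy `D` halts with value `c`. Here `D l x` says that `x` is the
response of the strategy to the list `l` of oracle answers: `pTc` to halt with value `c`, and `pFv`
to ask for `f(v)`. -/
inductive Halts (f : A →. A) : (List A → A → Prop) → A → Prop
  | done {D : List A → A → Prop} {c : A} (h : D [] (M.pair M.T c)) : Halts f D c
  | ask {D : List A → A → Prop} {c v u : A} (h : D [] (M.pair M.F v)) (hu : u ∈ f v)
      (hD : Halts f (fun l => D (u :: l)) c) : Halts f D c

variable {M}

theorem Halts.mono {f f' : A →. A} {D D' : List A → A → Prop} {c : A} (h : M.Halts f D c)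
    (hf : ∀ a b, b ∈ f a → b ∈ f' a) (hD : ∀ l x, D l x → D' l x) : M.Halts f' D' c := by
  induction h generalizing D' with
  | done h => exact .done (hD _ _ h)
  | ask h hu _ ih => exact .ask (hD _ _ h) (hf _ _ hu) (ih fun l x => hD _ x)

theorem halts_iff {f : A →. A} {D : List A → A → Prop} {c : A} :
    M.Halts f D c ↔ ∃ u : List A, (∀ (i : ℕ) (hi : i < u.length), ∃ v : A,
      D (u.take i) (M.pair M.F v) ∧ u[i] ∈ f v) ∧ D u (M.pair M.T c) := by
  constructor
  · intro h
    induction h with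
    | done h => exact ⟨[], by simp, h⟩
    | @ask D c v u h hu _ ih =>
      obtain ⟨l, hl, hc⟩ := ih
      refine ⟨u :: l, fun i hi => ?_, hc⟩
      cases i with
      | zero => exact ⟨v, h, hu⟩
      | succ i => exact hl i (by simpa using hi)
  · rintro ⟨u, hu, hc⟩
    induction u generalizing D with
    | nil => exact .done hc
    | cons a u ih =>
      obtain ⟨v, hv, ha⟩ := hu 0 (by simp)
      exact .ask hv ha (ih (fun i hi => hu (i + 1) (by simpa using hi)) hc)

theorem mem_oracleApp_iff_halts {f : A →. A} {a b c : A} :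
    c ∈ M.oracleApp f a b ↔ M.Halts f (fun l x => x ∈ M.app a (M.tuple (b :: l))) c := by
  rw [mem_oracleApp, halts_iff]
  rfl

theorem mem_oracleApp_of_T {f : A →. A} {a b c : A} (h : M.pair M.T c ∈ M.app a (M.tuple [b])) :
    c ∈ M.oracleApp f a b :=
  mem_oracleApp_iff_halts.2 (.done h)

theorem oracleApp_mono {f f' : A →. A} (hf : ∀ a b, b ∈ f a → b ∈ f' a) {a b c : A}
    (h : c ∈ M.oracleApp f a b) : c ∈ M.oracleApp f' a b :=
  mem_oracleApp_iff_halts.2 ((mem_oracleApp_iff_halts.1 h).mono hf fun _ _ h => h)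

variable (M)

/-- An initial segment of a tuple is stored as the function that prepends it. Appending one more
entry (`exists_step`) is then a composition and needs no recursion on tuples. -/
theorem exists_init : ∃ i : A, ∀ b, ∃ q ∈ M.app i b, ∀ s, M.pair M.F (M.pair b s) ∈ M.app q s := by
  refine ⟨M.clo 0 (fun _ => M.k) (M.lam 1 (M.pairT (.const M.F) (M.pairT (.var 0) (.var 1)))),
    fun b => ⟨_, by rw [app_clo_lam]; exact Part.mem_some _, fun s => mem_app_clo ?_⟩⟩
  simp

theorem exists_step : ∃ t : A, ∀ q, ∃ r ∈ M.app t q, ∀ u, ∃ q' ∈ M.app r u,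
    ∀ s, ∀ y ∈ M.app q (M.pair M.F (M.pair u s)), y ∈ M.app q' s := by
  refine ⟨M.clo 0 (fun _ => M.k) (M.lam 1 (M.lam 2
    (.app (.var 0) (M.pairT (.const M.F) (M.pairT (.var 1) (.var 2)))))),
    fun q => ⟨_, by rw [app_clo_lam]; exact Part.mem_some _, fun u =>
    ⟨_, by rw [app_clo_lam]; exact Part.mem_some _, fun s y hy => mem_app_clo ?_⟩⟩⟩
  simpa using hy

/-- There is an element that simulates the dialogue of a strategy `a` and passes the value and the
unused oracle answers on to a continuation `κ`. The answers that were used so far are recorded by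
`q`, which prepends them to a tuple. -/
theorem exists_run : ∃ (R : A) (run : A → A → A → A),
    (∀ a q κ, ∃ x ∈ M.app R a, ∃ y ∈ M.app x q, run a q κ ∈ M.app y κ) ∧
    (∀ a q κ t x h l c, t ∈ M.app q (M.tuple []) → M.pair M.T x ∈ M.app a t → h ∈ M.app κ x →
      c ∈ M.app h l → c ∈ M.app (run a q κ) l) ∧
    ∀ a q κ t v, t ∈ M.app q (M.tuple []) → M.pair M.F v ∈ M.app a t →
      M.pair M.F v ∈ M.app (run a q κ) (M.tuple []) ∧
      ∀ u, ∃ q', (∀ s, ∀ y ∈ M.app q (M.pair M.F (M.pair u s)), y ∈ M.app q' s) ∧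
        ∀ l, ∀ c ∈ M.app (run a q' κ) l, c ∈ M.app (run a q κ) (M.pair M.F (M.pair u l)) := by
  obtain ⟨st, hst⟩ := M.exists_step
  -- Variables 0 to 4 are the program itself, $a$, $q$, $\kappa$ and the list of unused answers. If
  -- $a(q[\,])$ is a query, it is issued when the list is empty. Otherwise the head of the list
  -- answers it: the head is absorbed into $q$ and the program recurses on the tail.
  let body : CTerm A := M.caseT (.app (.var 1) (.app (.var 2) (.const (M.tuple []))))
    (M.lam 5 (.app (.app (.var 3) (.var 5)) (.var 4)))
    (M.lam 5 (M.caseT (.var 4) (M.lam 6 (M.pairT (.const M.F) (.var 5)))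
      (M.lam 6 (.app (.app (.app (.app (.var 0) (.var 1))
        (.app (.app (.const st) (.var 2)) (.app (.var 6) (.const M.T)))) (.var 3))
        (.app (.var 6) (.const M.F))))))
  obtain ⟨R, hR⟩ := M.exists_fix_eval 0 1 (fun _ => M.k) (M.lam 2 (M.lam 3 (M.lam 4 body)))
  let env (a q κ : A) : ℕ → A := Function.update (Function.update (Function.update
    (Function.update (fun _ => M.k) 0 R) 1 a) 2 q) 3 κ
  have hdef : ∀ a q κ, ∃ x ∈ M.app R a, ∃ y ∈ M.app x q, M.clo 4 (env a q κ) body ∈ M.app y κ :=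
    fun a q κ => ⟨_, hR a _ (by rw [eval_lam]; exact Part.mem_some _),
      _, by rw [app_clo_lam]; exact Part.mem_some _, by rw [app_clo_lam]; exact Part.mem_some _⟩
  refine ⟨R, fun a q κ => M.clo 4 (env a q κ) body, hdef, ?_, ?_⟩
  · intro a q κ t x h l c ht hx hh hc
    refine mem_app_clo (mem_eval_caseT_T (x := x) ?_ ?_)
    · simpa [env] using ⟨t, ht, hx⟩
    · simpa [env] using ⟨h, hh, hc⟩
  · intro a q κ t v ht hv
    have hm : ∀ l, M.pair M.F v ∈ M.eval (Function.update (env a q κ) 4 l)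
        (.app (.var 1) (.app (.var 2) (.const (M.tuple [])))) := fun l => by
      simpa [env] using ⟨t, ht, hv⟩
    constructor
    · refine mem_app_clo (mem_eval_caseT_F (hm _) (mem_eval_caseT_T (x := M.T) ?_ ?_))
      · simp [tuple]
      · simp
    · intro u
      obtain ⟨r, hr, hr'⟩ := hst q
      obtain ⟨q', hq', h'⟩ := hr' u
      refine ⟨q', h', fun l c hc => mem_app_clo (mem_eval_caseT_F (hm _)
        (mem_eval_caseT_F (x := M.pair u l) ?_ ?_))⟩
      · simp
      · obtain ⟨x, hx, y, hy, hz⟩ := hdef a q' κ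
        simpa [env] using ⟨_, ⟨y, ⟨x, hx, q', ⟨r, hr, hq'⟩, hy⟩, hz⟩, hc⟩

variable {M}

/-- This concatenates two dialogues, by induction on that of $a$. Each answer moves from the list
into $q$, and once $a$ halts with $x$ the remaining strategy is $\kappa x$, which sees only the
later answers. -/
theorem halts_of_run {run : A → A → A → A}
    (hT : ∀ a q κ t x h l c, t ∈ M.app q (M.tuple []) → M.pair M.T x ∈ M.app a t →
      h ∈ M.app κ x → c ∈ M.app h l → c ∈ M.app (run a q κ) l)
    (hF : ∀ a q κ t v, t ∈ M.app q (M.tuple []) → M.pair M.F v ∈ M.app a t →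
      M.pair M.F v ∈ M.app (run a q κ) (M.tuple []) ∧
      ∀ u, ∃ q', (∀ s, ∀ y ∈ M.app q (M.pair M.F (M.pair u s)), y ∈ M.app q' s) ∧
        ∀ l, ∀ c ∈ M.app (run a q' κ) l, c ∈ M.app (run a q κ) (M.pair M.F (M.pair u l)))
    {f : A →. A} {D D' : List A → A → Prop} {a q κ h x y : A} (hD : M.Halts f D x)
    (hq : ∀ l c, D l c → ∃ t ∈ M.app q (M.tuple l), c ∈ M.app a t)
    (hκ : h ∈ M.app κ x) (hy : M.Halts f (fun l c => c ∈ M.app h (M.tuple l)) y)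
    (hD' : ∀ l, ∀ c ∈ M.app (run a q κ) (M.tuple l), D' l c) : M.Halts f D' y := by
  induction hD generalizing q D' with
  | done hx =>
    obtain ⟨t, ht, hx⟩ := hq _ _ hx
    exact hy.mono (fun _ _ h => h) fun l c hc => hD' l c (hT _ _ _ _ _ _ _ _ ht hx hκ hc)
  | @ask D x v u hv hu _ ih =>
    obtain ⟨t, ht, hv⟩ := hq _ _ hv
    obtain ⟨h1, h2⟩ := hF a q κ t v ht hv
    obtain ⟨q', hq', hr⟩ := h2 u
    refine .ask (hD' _ _ h1) hu (ih (q := q') (fun l c hc => ?_) hκ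
      fun l c hc => hD' _ _ (hr _ _ hc))
    obtain ⟨t, ht, hc⟩ := hq _ _ hc
    exact ⟨t, hq' _ _ ht, hc⟩

/-! ### The pca structure of $A[f]$. -/

variable (M)

theorem exists_oracle_k (f : A →. A) : ∃ k : A, ∀ a, ∃ x ∈ M.oracleApp f k a,
    ∀ b, a ∈ M.oracleApp f x b := by
  let t : CTerm A := M.pairT (.const M.T)
    (.app (.app (.var 0) (.const M.F)) (.const M.T))
  refine ⟨M.clo 0 (fun _ => M.k) (M.pairT (.const M.T) (M.lam 1 t)), fun a =>
    ⟨M.clo 1 (Function.update (fun _ => M.k) 0 (M.tuple [a])) t,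
      mem_oracleApp_of_T (mem_app_clo ?_), fun b => mem_oracleApp_of_T (mem_app_clo ?_)⟩⟩
  · simp
  · simp [t, tuple]

theorem exists_oracle_s (f : A →. A) : ∃ s : A, ∀ a, ∃ sa ∈ M.oracleApp f s a,
    ∀ b, ∃ sab ∈ M.oracleApp f sa b, ∀ c x y z, x ∈ M.oracleApp f a c → y ∈ M.oracleApp f b c →
      z ∈ M.oracleApp f x y → z ∈ M.oracleApp f sab c := by
  obtain ⟨R, run, hdef, hT, hF⟩ := M.exists_run
  obtain ⟨i, hi⟩ := M.exists_init
  let R4 (a q κ : CTerm A) : CTerm A := .app (.app (.app (.const R) a) (.app (.const i) q)) κ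
  -- Since $[b]*u=\mathsf{pF}(\mathsf pbu)$, applying to $\mathsf F$ and then $\mathsf T$ extracts
  -- the head, and to $\mathsf F$ twice the tail.
  let arg (n : ℕ) : CTerm A := .app (.app (.var n) (.const M.F)) (.const M.T)
  -- Three nested runs: $a$ on $c$ passes its value $x$ to $\kappa_1$, which runs $b$ on $c$; its
  -- value $y$ goes to $\kappa_2$, which runs $x$ on $y$; $\kappa_3$ then halts with the result.
  let κ₃ : CTerm A := M.lam 5 (M.lam 6 (M.pairT (.const M.T) (.var 5)))
  let κ₂ : CTerm A := M.lam 4 (R4 (.var 3) (.var 4) κ₃)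
  let κ₁ : CTerm A := M.lam 3 (R4 (arg 1) (.var 7) κ₂)
  let G : CTerm A := R4 (arg 0) (.var 7) κ₁
  let t : CTerm A := .app (.app (.var 8) (arg 2)) (.app (.app (.var 2) (.const M.F)) (.const M.F))
  let t' : CTerm A := M.pairT (.const M.T) (.app (M.lam 8 (M.lam 2 t)) (M.lam 7 G))
  let ρ : ℕ → A := fun _ => M.k
  have hR4 : ∀ ρ a' q' κ' a b q κ, a ∈ M.eval ρ a' → b ∈ M.eval ρ q' → κ ∈ M.eval ρ κ' →
      q ∈ M.app i b → run a q κ ∈ M.eval ρ (R4 a' q' κ') := by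
    intro ρ a' q' κ' a b q κ ha hb hκ hq
    obtain ⟨x, hx, y, hy, hz⟩ := hdef a q κ
    simp only [R4, mem_eval_app]
    exact ⟨y, ⟨x, ⟨R, by simp, a, ha, hx⟩, q, ⟨i, by simp, b, hb, hq⟩, hy⟩, κ, hκ, hz⟩
  refine ⟨M.clo 0 ρ (M.pairT (.const M.T) (M.lam 1 t')), fun a =>
    ⟨M.clo 1 (Function.update ρ 0 (M.tuple [a])) t',
      mem_oracleApp_of_T (mem_app_clo (by simp)), fun b =>
    ?_⟩⟩
  let ρ₁ := Function.update (Function.update ρ 0 (M.tuple [a])) 1 (M.tuple [b])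
  refine ⟨M.clo 2 (Function.update ρ₁ 8 (M.clo 7 ρ₁ G)) t,
    mem_oracleApp_of_T (mem_app_clo (by simp [t', ρ₁])), fun c x y z hx hy hz => ?_⟩
  rw [mem_oracleApp_iff_halts] at hx hy hz ⊢
  obtain ⟨q, hq, hq'⟩ := hi c
  obtain ⟨r, hr, hr'⟩ := hi y
  let ρ₇ := Function.update ρ₁ 7 c
  let ρ₃ := Function.update ρ₇ 3 x
  let ρ₄ := Function.update ρ₃ 4 y
  have h₁ : run a q (M.clo 3 ρ₇ (R4 (arg 1) (.var 7) κ₂)) ∈ M.app (M.clo 7 ρ₁ G) c :=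
    mem_app_clo (hR4 _ _ _ _ _ c _ _ (by simp [arg, ρ₁, tuple]) (by simp) (by simp [κ₁, ρ₇]) hq)
  have h₂ : run b q (M.clo 4 ρ₃ (R4 (.var 3) (.var 4) κ₃)) ∈
      M.app (M.clo 3 ρ₇ (R4 (arg 1) (.var 7) κ₂)) x :=
    mem_app_clo (hR4 _ _ _ _ _ c _ _ (by simp [arg, ρ₇, ρ₁, tuple]) (by simp [ρ₇])
      (by simp [κ₂, ρ₃]) hq)
  have h₃ : run x r (M.clo 5 ρ₄ (M.lam 6 (M.pairT (.const M.T) (.var 5)))) ∈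
      M.app (M.clo 4 ρ₃ (R4 (.var 3) (.var 4) κ₃)) y :=
    mem_app_clo (hR4 _ _ _ _ _ y _ _ (by simp [ρ₃]) (by simp)
      (by simp [κ₃, ρ₄]) hr)
  refine halts_of_run hT hF hx (fun l c hc => ⟨_, hq' _, hc⟩) h₂ ?_ fun l c' hc => mem_app_clo ?_
  · refine halts_of_run hT hF hy (fun l c hc => ⟨_, hq' _, hc⟩) h₃ ?_ fun l c hc => hc
    refine halts_of_run hT hF hz (fun l c hc => ⟨_, hr' _, hc⟩)
      (by rw [app_clo_lam]; exact Part.mem_some _) (.done (mem_app_clo ?_)) fun l c hc => hc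
    simp
  · simpa [t, arg, tuple] using ⟨_, h₁, hc⟩

theorem exists_oraclePCA (f : A →. A) : ∃ N : PCA A, N.app = M.oracleApp f := by
  obtain ⟨k, hk⟩ := M.exists_oracle_k f
  obtain ⟨s, hs⟩ := M.exists_oracle_s f
  refine ⟨⟨M.oracleApp f, k, s, fun a b => ?_, fun a b => ?_, fun a b c z hz => ?_⟩, rfl⟩
  · obtain ⟨x, hx, h⟩ := hs a
    obtain ⟨y, hy, -⟩ := h b
    exact Part.dom_iff_mem.2 ⟨y, by simpa [PAS.ap] using ⟨x, hx, hy⟩⟩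
  · obtain ⟨x, hx, h⟩ := hk a
    exact Part.eq_some_iff.2 (by simpa [PAS.ap] using ⟨x, hx, h b⟩)
  · obtain ⟨x, hx, h⟩ := hs a
    obtain ⟨y, hy, h⟩ := h b
    simp only [PAS.ap, Part.mem_bind_iff] at hz
    obtain ⟨p, hp, q, hq, hz⟩ := hz
    simpa [PAS.ap] using ⟨y, ⟨x, hx, hy⟩, h c p q z hp hq hz⟩

/-- This realizes $\iota_F$: the element $a$ becomes a strategy that halts with $ab$ without
consulting the oracle. -/
theorem exists_oracle_realizer (f : A →. A) : ∃ r : A, ∀ a, ∃ x ∈ M.oracleApp f r a,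
    ∀ b, ∀ c ∈ M.app a b, c ∈ M.oracleApp f x b := by
  let arg (n : ℕ) : CTerm A := .app (.app (.var n) (.const M.F)) (.const M.T)
  let t : CTerm A := M.pairT (.const M.T) (.app (arg 0) (arg 1))
  refine ⟨M.clo 0 (fun _ => M.k) (M.pairT (.const M.T) (M.lam 1 t)), fun a =>
    ⟨M.clo 1 (Function.update (fun _ => M.k) 0 (M.tuple [a])) t,
      mem_oracleApp_of_T (mem_app_clo ?_), fun b c hc => mem_oracleApp_of_T (mem_app_clo ?_)⟩⟩
  · simp
  · simpa [t, arg, tuple] using ⟨c, hc, rfl⟩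

/-- The oracle `f` has an index in `A[f]`. -/
theorem exists_oracle_index (f : A →. A) : ∃ a : A, ∀ b, ∀ c ∈ f b, c ∈ M.oracleApp f a b := by
  -- The tail of the input is $\mathsf{pTT}$ or $\mathsf{pF}(\mathsf pc\cdots)$, hence can itself be
  -- tested: in the first case the head is asked, in the second the answer $c$ is returned.
  let rest : CTerm A := .app (.app (.var 0) (.const M.F)) (.const M.F)
  let t : CTerm A := M.caseT rest
    (M.lam 1 (M.pairT (.const M.F) (.app (.app (.var 0) (.const M.F)) (.const M.T))))
    (M.lam 1 (M.pairT (.const M.T) (.app (.var 1) (.const M.T))))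
  refine ⟨M.clo 0 (fun _ => M.k) t, fun b c hc => mem_oracleApp_iff_halts.2
    (.ask (mem_app_clo (mem_eval_caseT_T (x := M.T) ?_ ?_)) hc
      (.done (mem_app_clo (mem_eval_caseT_F (x := M.pair c (M.tuple [])) ?_ ?_))))⟩
  · simp [rest, tuple]
  · simp [tuple]
  · simp [rest, tuple]
  · simp

end PCA

/-! ### The transfinite stages and their closure. -/

namespace PCA

variable {A : Type u}

theorem of_mem_ofGraph {R : A → A → Prop} {a b : A} (h : b ∈ ofGraph R a) : R a b := by
  obtain ⟨h, rfl⟩ := h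
  exact h.choose_spec

theorem mem_ofGraph {R : A → A → Prop} {a b : A} (hR : ∀ b', R a b' → b' = b) (h : R a b) :
    b ∈ ofGraph R a :=
  ⟨⟨b, h⟩, hR _ (Exists.choose_spec (⟨b, h⟩ : ∃ b, R a b))⟩

variable (M : PCA A) (Φ : (A → A) →. A)

/-- The graph of `f_{α+1}` in terms of `f = f_α`. -/
def StageRel (f : A →. A) (a b : A) : Prop :=
  ∃ g ∈ (M.oracleApp f).Tot, a ∈ (M.oracleApp f).I₁ g ∧ b ∈ Φ g

variable {M Φ}

/-- Total functions with a common index are equal. -/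
theorem stageRel_unique {f : A →. A} {a b b' : A} (h : M.StageRel Φ f a b)
    (h' : M.StageRel Φ f a b') : b = b' := by
  obtain ⟨g, -, hg, hb⟩ := h
  obtain ⟨g', -, hg', hb'⟩ := h'
  have : g = g' := funext fun x =>
    Part.mem_unique (hg x (g x) (Part.mem_some _)) (hg' x (g' x) (Part.mem_some _))
  subst this
  exact Part.mem_unique hb hb'

theorem StageRel.mono {f f' : A →. A} (hf : ∀ a b, b ∈ f a → b ∈ f' a) {a b : A}
    (h : M.StageRel Φ f a b) : M.StageRel Φ f' a b := by
  obtain ⟨g, -, hg, hb⟩ := h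
  have hg' : a ∈ (M.oracleApp f').I₁ g := fun x c hc => oracleApp_mono hf (hg x c hc)
  exact ⟨g, ⟨a, hg'⟩, hg', hb⟩

theorem stage_zero : M.stage Φ 0 = fun _ => Part.none :=
  Ordinal.limitRecOn_zero ..

theorem stage_add_one (α : Ordinal.{u}) :
    M.stage Φ (α + 1) = ofGraph (M.StageRel Φ (M.stage Φ α)) :=
  Ordinal.limitRecOn_add_one ..

theorem stage_limit {l : Ordinal.{u}} (hl : Order.IsSuccLimit l) :
    M.stage Φ l = ofGraph fun a b => ∃ (β : Ordinal.{u}) (_ : β < l), b ∈ M.stage Φ β a :=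
  Ordinal.limitRecOn_limit _ _ _ _ hl

theorem mem_stage_add_one {α : Ordinal.{u}} {a b : A} :
    b ∈ M.stage Φ (α + 1) a ↔ M.StageRel Φ (M.stage Φ α) a b := by
  rw [stage_add_one]
  exact ⟨of_mem_ofGraph, fun h => mem_ofGraph (fun b' h' => stageRel_unique h' h) h⟩

theorem exists_stageRel_of_mem_stage {α : Ordinal.{u}} {a b : A} (h : b ∈ M.stage Φ α a) :
    ∃ β < α, M.StageRel Φ (M.stage Φ β) a b := by
  induction α using Ordinal.limitRecOn with
  | zero => exact absurd h (by rw [stage_zero]; exact Part.notMem_none b)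
  | add_one α ih => exact ⟨α, lt_add_one α, mem_stage_add_one.1 h⟩
  | limit l hl ih =>
    rw [stage_limit hl] at h
    obtain ⟨β, hβ, h⟩ := of_mem_ofGraph h
    obtain ⟨δ, hδ, h⟩ := ih β hβ h
    exact ⟨δ, hδ.trans hβ, h⟩

theorem stage_mono {α β : Ordinal.{u}} (hαβ : α ≤ β) {a b : A} (h : b ∈ M.stage Φ α a) :
    b ∈ M.stage Φ β a := by
  induction β using WellFoundedLT.induction generalizing α a b with
  | ind β ih =>
    rcases hαβ.eq_or_lt with rfl | hlt
    · exact h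
    have aux : β ≠ 0 := (zero_le.trans_lt hlt).ne'
    induction β using Ordinal.limitRecOn with
    | zero => exact absurd rfl aux
    | add_one β _ =>
      -- A value in $f_\beta$ was produced from some $f_\delta$ with $\delta<\beta$, and
      -- $f_\delta\subseteq f_\beta$ by induction, so the same $g$ produces it from $f_\beta$.
      have h := ih β (lt_add_one β) (Order.lt_add_one_iff.1 hlt) h
      obtain ⟨δ, hδ, h⟩ := exists_stageRel_of_mem_stage h
      exact mem_stage_add_one.2 (h.mono fun _ _ => ih β (lt_add_one β) hδ.le)
    | limit l hl _ =>
      rw [stage_limit hl]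
      refine mem_ofGraph (fun b' => ?_) ⟨α, hlt, h⟩
      rintro ⟨δ, hδ, h'⟩
      -- Single-valuedness of the union: both values already occur at the larger of the two stages,
      -- which is still below the limit.
      have hm := max_lt hδ hlt
      exact Part.mem_unique (ih _ hm (le_max_left _ _) h') (ih _ hm (le_max_right _ _) h)

theorem mem_stageUnion {a b : A} :
    b ∈ M.stageUnion Φ a ↔ ∃ α : Ordinal.{u}, b ∈ M.stage Φ α a := by
  refine ⟨of_mem_ofGraph, fun h => mem_ofGraph (fun b' h' => ?_) h⟩
  obtain ⟨α, h⟩ := h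
  obtain ⟨β, h'⟩ := h'
  exact Part.mem_unique (stage_mono (le_max_right α β) h') (stage_mono (le_max_left α β) h)

variable (M Φ)

theorem exists_stage_eq_stageUnion :
    ∃ α : Ordinal.{u}, ∀ a b, b ∈ M.stageUnion Φ a → b ∈ M.stage Φ α a := by
  have h : ∀ p : A × A, ∃ α : Ordinal.{u}, p.2 ∈ M.stageUnion Φ p.1 → p.2 ∈ M.stage Φ α p.1 := by
    intro p
    by_cases hp : p.2 ∈ M.stageUnion Φ p.1
    · obtain ⟨α, h⟩ := mem_stageUnion.1 hp
      exact ⟨α, fun _ => h⟩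
    · exact ⟨0, fun h => absurd h hp⟩
  choose o ho using h
  -- The supremum exists because $A\times A$ lies in the universe of the ordinals.
  exact ⟨⨆ p, o p, fun a b hab => stage_mono (Ordinal.le_iSup o (a, b)) (ho (a, b) hab)⟩

variable {M Φ}

theorem mem_stageUnion_of_stageRel {a b : A} (h : M.StageRel Φ (M.stageUnion Φ) a b) :
    b ∈ M.stageUnion Φ a := by
  obtain ⟨α, hα⟩ := M.exists_stage_eq_stageUnion Φ
  exact mem_stageUnion.2 ⟨α + 1, mem_stage_add_one.2 (h.mono hα)⟩

end PCA

/-! ### Elementwise realizers, decidability and effective operations of morphisms. -/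

theorem PAS.setDefined_and_setApp_subset_iff {A : Type u} {m : PAS A} {t : A} {P Q : Set A} :
    m.SetDefined {t} P ∧ m.setApp {t} P ⊆ Q ↔ ∀ p ∈ P, ∃ c ∈ m t p, c ∈ Q := by
  constructor
  · rintro ⟨h, h'⟩ p hp
    have hc := Part.get_mem (h t rfl p hp)
    exact ⟨_, hc, h' ⟨t, rfl, p, hp, hc⟩⟩
  · refine fun h => ⟨?_, ?_⟩
    · rintro _ rfl p hp
      obtain ⟨c, hc, -⟩ := h p hp
      exact Part.dom_iff_mem.2 ⟨c, hc⟩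
    · rintro c ⟨_, rfl, p, hp, hc⟩
      obtain ⟨c', hc', h⟩ := h p hp
      rwa [Part.mem_unique hc hc']

theorem PAS.setDefined_and_setApp_eq_singleton_iff {A : Type u} {m : PAS A} {t y : A} {P : Set A}
    (hP : P.Nonempty) : m.SetDefined {t} P ∧ m.setApp {t} P = {y} ↔ ∀ p ∈ P, y ∈ m t p := by
  constructor
  · rintro ⟨h, h'⟩ p hp
    obtain ⟨c, hc, rfl⟩ := setDefined_and_setApp_subset_iff.1 ⟨h, h'.subset⟩ p hp
    exact hc
  · intro h
    obtain ⟨h1, h2⟩ := setDefined_and_setApp_subset_iff.2 fun p hp => ⟨y, h p hp, Set.mem_singleton y⟩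
    obtain ⟨p, hp⟩ := hP
    exact ⟨h1, h2.antisymm (Set.singleton_subset_iff.2 ⟨t, rfl, p, hp, h p hp⟩)⟩

namespace ApplicativeMorphism

variable {A : Type u} {B : Type v} {M : PCA A} {L : PCA B}

theorem exists_realizer (γ : ApplicativeMorphism M L) : ∃ r : B, ∀ {a a' c x y}, c ∈ M.app a a' →
    x ∈ γ.rel a → y ∈ γ.rel a' → ∃ z ∈ L.app r x, ∃ t ∈ L.app z y, t ∈ γ.rel c := by
  obtain ⟨r, hr⟩ := γ.realized
  refine ⟨r, fun {a a' c x y} hc hx hy => ?_⟩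
  obtain ⟨h1, h2, h3⟩ := hr a a' c hc
  have hz := Part.get_mem (h1 r rfl x hx)
  have hzm : _ ∈ L.app.setApp {r} (γ.rel a) := ⟨r, rfl, x, hx, hz⟩
  have ht := Part.get_mem (h2 _ hzm y hy)
  exact ⟨_, hz, _, ht, h3 ⟨_, hzm, y, hy, ht⟩⟩

/-- An applicative morphism from a relation with an elementwise realizer. -/
def ofRealizer (rel : A → Set B) (total : ∀ a, (rel a).Nonempty)
    (h : ∃ r : B, ∀ a a' c x y, c ∈ M.app a a' → x ∈ rel a → y ∈ rel a' →
      ∃ z ∈ L.app r x, ∃ t ∈ L.app z y, t ∈ rel c) : ApplicativeMorphism M L where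
  rel := rel
  total := total
  realized := by
    obtain ⟨r, hr⟩ := h
    refine ⟨r, fun a a' c hc => ⟨?_, ?_, ?_⟩⟩
    · rintro _ rfl x hx
      obtain ⟨y, hy⟩ := total a'
      obtain ⟨z, hz, -⟩ := hr _ _ _ _ _ hc hx hy
      exact Part.dom_iff_mem.2 ⟨z, hz⟩
    · rintro z ⟨_, rfl, x, hx, hz⟩ y hy
      obtain ⟨z', hz', t, ht, -⟩ := hr _ _ _ _ _ hc hx hy
      obtain rfl := Part.mem_unique hz hz'
      exact Part.dom_iff_mem.2 ⟨t, ht⟩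
    · rintro t ⟨z, ⟨_, rfl, x, hx, hz⟩, y, hy, ht⟩
      obtain ⟨z', hz', t', ht', h⟩ := hr _ _ _ _ _ hc hx hy
      obtain rfl := Part.mem_unique hz hz'
      obtain rfl := Part.mem_unique ht ht'
      exact h

theorem isDecidable_iff {γ : ApplicativeMorphism M L} :
    γ.IsDecidable ↔ ∃ d : B, (∀ x ∈ γ.rel M.T, L.T ∈ L.app d x) ∧
      ∀ x ∈ γ.rel M.F, L.F ∈ L.app d x := by
  simp only [IsDecidable, PAS.setDefined_and_setApp_eq_singleton_iff (γ.total _)]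

theorem mem_I₁ {γ : ApplicativeMorphism M L} {g : A → A} {b : B} :
    b ∈ γ.I₁ g ↔ ∀ a, ∀ x ∈ γ.rel a, ∃ y ∈ L.app b x, y ∈ γ.rel (g a) := by
  simp [I₁, PAS.setDefined_and_setApp_subset_iff]

theorem mem_E {γ : ApplicativeMorphism M L} {Φ : (A → A) →. A} :
    Φ ∈ γ.E ↔ ∃ b : B, ∀ g : A → A, ∀ e ∈ γ.I₁ g, ∀ y ∈ Φ g, ∃ c ∈ L.app b e, c ∈ γ.rel y := by
  constructor
  · rintro ⟨b, hb⟩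
    exact ⟨b, fun g e he y hy =>
      PAS.setDefined_and_setApp_subset_iff.1 (hb g ⟨e, he⟩ y hy) e he⟩
  · rintro ⟨b, hb⟩
    exact ⟨b, fun g _ y hy =>
      PAS.setDefined_and_setApp_subset_iff.2 fun e he => hb g e he y hy⟩

/-- A morphism is decidable if its restriction along an identity relation is. -/
theorem isDecidable_of_comp {N : PCA A} {ι : ApplicativeMorphism M N} (hι : ∀ a, ι.rel a = {a})
    {δ : ApplicativeMorphism N L} (h : (δ.comp ι).IsDecidable) : δ.IsDecidable := by
  have hrel : ∀ a, (δ.comp ι).rel a = δ.rel a := fun a => by simp [comp, hι]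
  obtain ⟨d, hT, hF⟩ := isDecidable_iff.1 h
  obtain ⟨r, hr⟩ := δ.exists_realizer
  -- In $N$, the pair of the booleans of $M$ sends each boolean of $N$ to the corresponding one of
  -- $M$, which the given decider can handle.
  obtain ⟨p, hp⟩ := δ.total (N.pair M.T M.F)
  obtain ⟨x, hx⟩ := δ.total N.T
  obtain ⟨z, hz, -⟩ := hr (Part.eq_some_iff.1 (N.app_pair_T M.T M.F)) hp hx
  refine isDecidable_iff.2 ⟨L.S (L.K d) z, fun x hx => ?_, fun x hx => ?_⟩
  · obtain ⟨z', hz', t, ht, h⟩ := hr (Part.eq_some_iff.1 (N.app_pair_T M.T M.F)) hp hx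
    obtain rfl := Part.mem_unique hz hz'
    exact L.S_app (L.K_app d x) ht (hT t (by rwa [hrel]))
  · obtain ⟨z', hz', t, ht, h⟩ := hr (Part.eq_some_iff.1 (N.app_pair_F M.T M.F)) hp hx
    obtain rfl := Part.mem_unique hz hz'
    exact L.S_app (L.K_app d x) ht (hF t (by rwa [hrel]))

/-- An identity relation that is an applicative morphism is decidable. -/
theorem isDecidable_of_rel_eq_singleton {N : PCA A} {ι : ApplicativeMorphism M N}
    (hι : ∀ a, ι.rel a = {a}) : ι.IsDecidable := by
  obtain ⟨r, hr⟩ := ι.exists_realizer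
  have hr' : ∀ {a b c}, c ∈ M.app a b → ∃ z ∈ N.app r a, c ∈ N.app z b := by
    intro a b c hc
    obtain ⟨z, hz, t, ht, h⟩ := hr hc (by rw [hι]; rfl) (by rw [hι]; rfl)
    rw [hι] at h
    obtain rfl := h
    exact ⟨z, hz, ht⟩
  -- The decider is $x\mapsto x\,\mathsf T_N\,\mathsf F_N$, computed in $M$: the booleans of $M$
  -- select the matching boolean of $N$.
  have key : ∀ x y z, y ∈ M.app x N.T → z ∈ M.app y N.F →
      z ∈ N.app (N.S (N.S (N.K r) (N.S r (N.K N.T))) (N.K N.F)) x := by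
    intro x y z hy hz
    obtain ⟨y', hy', h1⟩ := hr' hy
    obtain ⟨z', hz', h2⟩ := hr' hz
    exact N.S_app (N.S_app (N.K_app _ _) (N.S_app hy' (N.K_app _ _) h1) hz') (N.K_app _ _) h2
  refine isDecidable_iff.2 ⟨N.S (N.S (N.K r) (N.S r (N.K N.T))) (N.K N.F),
    fun x hx => ?_, fun x hx => ?_⟩
  · rw [hι] at hx
    obtain rfl := hx
    exact key _ _ _ (M.K_mem _) (M.K_app _ _)
  · rw [hι] at hx
    obtain rfl := hx
    exact key _ _ _ (M.K_app _ _) (M.I_app _)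

/-- Effective operations of `N` and of an identity morphism into `N` agree. -/
theorem E_eq_of_rel_eq_singleton {N : PCA A} {ι : ApplicativeMorphism M N}
    (hι : ∀ a, ι.rel a = {a}) : N.app.E = ι.E := by
  have hI : ∀ g : A → A, N.app.I₁ g = ι.I₁ g := by
    intro g
    ext b
    rw [mem_I₁]
    simp [PAS.I₁, Lesssim, hι]
  ext Φ
  rw [mem_E]
  constructor
  · rintro ⟨a, ha⟩
    refine ⟨a, fun g e he y hy => ⟨y, ?_, by rw [hι]; rfl⟩⟩
    rw [← hI] at he
    exact (PAS.setDefined_and_setApp_eq_singleton_iff ⟨e, he⟩).1 (ha g ⟨e, he⟩ y hy) e he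
  · rintro ⟨a, ha⟩
    refine ⟨a, fun g hg y hy => (PAS.setDefined_and_setApp_eq_singleton_iff hg).2 fun e he => ?_⟩
    obtain ⟨c, hc, h⟩ := ha g e ((hI g).subset he) y hy
    rw [hι] at h
    exact h ▸ hc

/-! ### Extending $\gamma$ along $\iota_F$. -/

/-- A decidable morphism allows the simulation of dialogues: `loop z e x` continues the dialogue of
the strategy represented by `x` with the oracle represented by `e`, where `z` represents the
answers given so far. -/
theorem exists_loop {γ : ApplicativeMorphism M L} (hγ : γ.IsDecidable) :
    ∃ (R : B) (loop : B → B → B), (∀ z e, ∃ y ∈ L.app R z, loop z e ∈ L.app y e) ∧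
    ∀ (f : A →. A) (e : B), (∀ v, ∀ u ∈ f v, ∀ w ∈ γ.rel v, ∃ w' ∈ L.app e w, w' ∈ γ.rel u) →
    ∀ (a : A), ∀ x ∈ γ.rel a, ∀ (D : List A → A → Prop) (c : A), M.Halts f D c →
    ∀ q : A, (∀ l c, D l c → ∃ t ∈ M.app q (M.tuple l), c ∈ M.app a t) →
    ∀ z ∈ γ.rel q, ∃ y ∈ L.app (loop z e) x, y ∈ γ.rel c := by
  obtain ⟨d, hdT, hdF⟩ := isDecidable_iff.1 hγ
  obtain ⟨r, hr⟩ := γ.exists_realizer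
  obtain ⟨st, hst⟩ := M.exists_step
  obtain ⟨st', hst'⟩ := γ.total st
  let ev (a : A) : A := M.S M.I (M.K a)
  have hev : ∀ {a x y}, y ∈ M.app x a → y ∈ M.app (ev a) x := fun h =>
    M.S_app (M.I_app _) (M.K_app _ _) h
  obtain ⟨nil', hnil⟩ := γ.total (ev (M.tuple []))
  obtain ⟨fst', hfst⟩ := γ.total (ev M.T)
  obtain ⟨snd', hsnd⟩ := γ.total (ev M.F)
  let ap (t s : CTerm B) : CTerm B := .app (.app (.const r) t) s
  have hap : ∀ {ρ t s x y a b c}, x ∈ L.eval ρ t → y ∈ L.eval ρ s → x ∈ γ.rel a → y ∈ γ.rel b →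
      c ∈ M.app a b → ∃ z ∈ L.eval ρ (ap t s), z ∈ γ.rel c := by
    intro ρ t s x y a b c ht hs hx hy hc
    obtain ⟨z, hz, w, hw, h⟩ := hr hc hx hy
    refine ⟨w, ?_, h⟩
    simp only [ap, PCA.mem_eval_app]
    exact ⟨z, ⟨r, by simp, x, ht, hz⟩, y, hs, hw⟩
  let m : CTerm B := ap (.var 3) (ap (.const nil') (.var 1))
  let next : CTerm B := .app (.app (.app (.var 0)
    (ap (ap (.const st') (.var 1)) (.app (.var 2) (.var 4)))) (.var 2)) (.var 3)
  -- Here $m$ represents the response $a(q[\,])$. The decider reads its tag and selects either the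
  -- identity, returning the value, or the next round, in which $e$ answers the query.
  let body : CTerm B := .app (.app (.app (.app (.const d) (ap (.const fst') m)) (.const L.I))
    (L.lam 4 next)) (ap (.const snd') m)
  obtain ⟨R, hR⟩ := L.exists_fix_eval 0 1 (fun _ => L.k) (L.lam 2 (L.lam 3 body))
  let env (z e : B) : ℕ → B := Function.update (Function.update
    (Function.update (fun _ => L.k) 0 R) 1 z) 2 e
  have hdef : ∀ z e, ∃ y ∈ L.app R z, L.clo 3 (env z e) body ∈ L.app y e := fun z e =>
    ⟨_, hR z _ (by rw [PCA.eval_lam]; exact Part.mem_some _),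
      by rw [PCA.app_clo_lam]; exact Part.mem_some _⟩
  refine ⟨R, fun z e => L.clo 3 (env z e) body, hdef, ?_⟩
  intro f e he a x hx D c hD
  induction hD with
  | @done D c hD =>
    intro q hq z hz
    obtain ⟨t, ht, hc⟩ := hq _ _ hD
    let ρ := Function.update (env z e) 3 x
    obtain ⟨y₁, hy₁, h₁⟩ := hap (ρ := ρ) (t := .const nil') (s := .var 1)
      (Part.mem_some _) (Part.mem_some _) hnil hz (hev ht)
    obtain ⟨y₂, hy₂, h₂⟩ := hap (t := .var 3) (Part.mem_some _) hy₁ hx h₁ hc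
    obtain ⟨y₃, hy₃, h₃⟩ := hap (t := .const fst') (Part.mem_some _) hy₂ hfst h₂
      (hev (Part.eq_some_iff.1 (M.app_pair_T _ _)))
    obtain ⟨y₄, hy₄, h₄⟩ := hap (t := .const snd') (Part.mem_some _) hy₂ hsnd h₂
      (hev (Part.eq_some_iff.1 (M.app_pair_F _ _)))
    refine ⟨y₄, PCA.mem_app_clo ?_, h₄⟩
    simp only [body, PCA.mem_eval_app]
    exact ⟨L.I, ⟨L.K L.I, ⟨L.T, ⟨d, Part.mem_some _, y₃, hy₃, hdT _ h₃⟩, L.I, Part.mem_some _,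
      L.K_mem _⟩, L.clo 4 ρ next, by rw [PCA.eval_lam]; exact Part.mem_some _, L.K_app _ _⟩,
      y₄, hy₄, L.I_app _⟩
  | @ask D c v u hv hu _ ih =>
    intro q hq z hz
    obtain ⟨t, ht, hc⟩ := hq _ _ hv
    let ρ := Function.update (env z e) 3 x
    obtain ⟨y₁, hy₁, h₁⟩ := hap (ρ := ρ) (t := .const nil') (s := .var 1)
      (Part.mem_some _) (Part.mem_some _) hnil hz (hev ht)
    obtain ⟨y₂, hy₂, h₂⟩ := hap (t := .var 3) (Part.mem_some _) hy₁ hx h₁ hc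
    obtain ⟨y₃, hy₃, h₃⟩ := hap (t := .const fst') (Part.mem_some _) hy₂ hfst h₂
      (hev (Part.eq_some_iff.1 (M.app_pair_T _ _)))
    obtain ⟨y₄, hy₄, h₄⟩ := hap (t := .const snd') (Part.mem_some _) hy₂ hsnd h₂
      (hev (Part.eq_some_iff.1 (M.app_pair_F _ _)))
    obtain ⟨w, hw, hwu⟩ := he v u hu y₄ h₄
    obtain ⟨sq, hsq, hsq'⟩ := hst q
    obtain ⟨q', hq', hqq'⟩ := hsq' u
    let ρ' := Function.update ρ 4 y₄
    obtain ⟨s₁, hs₁, k₁⟩ := hap (ρ := ρ') (t := .const st') (s := .var 1)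
      (Part.mem_some _) (Part.mem_some _) hst' hz hsq
    have hw' : w ∈ L.eval ρ' (.app (.var 2) (.var 4)) := by simpa [ρ', ρ, env] using hw
    obtain ⟨z', hz', k₂⟩ := hap hs₁ hw' k₁ hwu hq'
    obtain ⟨y, hy, hyc⟩ := ih q' (fun l c hc => by
      obtain ⟨t, ht, hc⟩ := hq _ _ hc
      exact ⟨t, hqq' _ _ ht, hc⟩) z' k₂
    refine ⟨y, PCA.mem_app_clo ?_, hyc⟩
    simp only [body, PCA.mem_eval_app]
    refine ⟨L.clo 4 ρ next, ⟨L.I, ⟨L.F, ⟨d, Part.mem_some _, y₃, hy₃, hdF _ h₃⟩, L.I,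
      Part.mem_some _, L.K_app _ _⟩, L.clo 4 ρ next,
      by rw [PCA.eval_lam]; exact Part.mem_some _, L.I_app _⟩, y₄, hy₄, PCA.mem_app_clo ?_⟩
    obtain ⟨g, hg, hg'⟩ := hdef z' e
    simp only [next, PCA.mem_eval_app]
    exact ⟨_, ⟨g, ⟨R, Part.mem_some _, z', hz', hg⟩, e, Part.mem_some _, hg'⟩, x,
      Part.mem_some _, hy⟩

/-- If `Φ` is effective relative to the decidable morphism `γ`, then `γ` also realizes the
application of `A[Φ]`. -/
theorem exists_realizer_stageUnion {γ : ApplicativeMorphism M L} (hγ : γ.IsDecidable)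
    {Φ : (A → A) →. A} (hΦ : Φ ∈ γ.E) : ∃ r : B, ∀ a a' c x y,
    c ∈ M.oracleApp (M.stageUnion Φ) a a' → x ∈ γ.rel a → y ∈ γ.rel a' →
    ∃ z ∈ L.app r x, ∃ t ∈ L.app z y, t ∈ γ.rel c := by
  obtain ⟨b, hb⟩ := mem_E.1 hΦ
  obtain ⟨R, loop, hdef, hloop⟩ := exists_loop hγ
  obtain ⟨r, hr⟩ := γ.exists_realizer
  obtain ⟨i, hi⟩ := M.exists_init
  obtain ⟨i', hi'⟩ := γ.total i
  let t : CTerm B := .app (.app (.app (.const R) (.app (.app (.const r) (.const i')) (.var 2)))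
    (.var 0)) (.var 1)
  -- The oracle $e$ sends $w$ to $b$ applied to the simulation of $w$, a simulation that itself
  -- consults $e$.
  obtain ⟨e, he⟩ := L.exists_fix_eval 0 1 (fun _ => L.k) (.app (.const b) (L.lam 2 t))
  let ρ (x : B) : ℕ → B := Function.update (Function.update (fun _ => L.k) 0 e) 1 x
  have hsim : ∀ f : A →. A,
      (∀ v, ∀ u ∈ f v, ∀ w ∈ γ.rel v, ∃ w' ∈ L.app e w, w' ∈ γ.rel u) →
      ∀ a a' c x y, c ∈ M.oracleApp f a a' → x ∈ γ.rel a → y ∈ γ.rel a' →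
      ∃ t' ∈ L.app (L.clo 2 (ρ x) t) y, t' ∈ γ.rel c := by
    intro f hf a a' c x y hc hx hy
    obtain ⟨q, hq, hq'⟩ := hi a'
    obtain ⟨z₀, hz₀, z, hz, hzq⟩ := hr hq hi' hy
    obtain ⟨t', ht', h⟩ := hloop f e hf a x hx _ c (PCA.mem_oracleApp_iff_halts.1 hc) q
      (fun l c hc => ⟨_, hq' _, hc⟩) z hzq
    obtain ⟨g, hg, hg'⟩ := hdef z e
    refine ⟨t', PCA.mem_app_clo ?_, h⟩
    simp only [t, PCA.mem_eval_app]
    exact ⟨_, ⟨g, ⟨R, Part.mem_some _, z, ⟨z₀, ⟨r, Part.mem_some _, i', Part.mem_some _, hz₀⟩, y,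
      Part.mem_some _, hz⟩, hg⟩, e, Part.mem_some _, hg'⟩, x, Part.mem_some _, ht'⟩
  have hstage : ∀ α : Ordinal.{u}, ∀ v, ∀ u ∈ M.stage Φ α v, ∀ w ∈ γ.rel v,
      ∃ w' ∈ L.app e w, w' ∈ γ.rel u := by
    intro α
    induction α using WellFoundedLT.induction with
    | ind α ih =>
      intro v u hu w hw
      obtain ⟨β, hβ, g, -, hv, hg⟩ := PCA.exists_stageRel_of_mem_stage hu
      -- The index $v$ computes $g$ with an earlier oracle $f_\beta$, which $e$ represents by
      -- induction. Simulating $w$ therefore represents $g$, and $b$ yields $F(g)$.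
      obtain ⟨c, hc, h⟩ := hb g (L.clo 2 (ρ w) t) (mem_I₁.2 fun a y hy =>
        hsim _ (ih β hβ) v a (g a) w y (hv a (g a) (Part.mem_some _)) hw hy) u hg
      refine ⟨c, he w c ?_, h⟩
      simp only [PCA.mem_eval_app, PCA.eval_lam]
      exact ⟨b, Part.mem_some _, _, Part.mem_some _, hc⟩
  refine ⟨L.clo 1 (Function.update (fun _ => L.k) 0 e) (L.lam 2 t), fun a a' c x y hc hx hy =>
    ⟨_, by rw [PCA.app_clo_lam]; exact Part.mem_some _, hsim (M.stageUnion Φ) ?_ _ _ _ _ _ hc hx hy⟩⟩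
  intro v u hu w hw
  obtain ⟨α, hα⟩ := PCA.mem_stageUnion.1 hu
  exact hstage α v u hα w hw

end ApplicativeMorphism

/-! ### Assembly of the theorem. -/

theorem mainTheorem1 {A : Type u} (M : PCA A) (Φ : (A → A) →. A) :
    -- the stages form a compatible family of partial functions
    (∀ α β : Ordinal.{u}, α ≤ β → ∀ a b, b ∈ M.stage Φ α a → b ∈ M.stage Φ β a) ∧
    -- `N = A[F]` is `A[f]` for the union `f` of the stages
    ∃ N : PCA A, N.app = M.oracleApp (M.stageUnion Φ) ∧
      ∃ ι : ApplicativeMorphism M N, (∀ a, ι.rel a = {a}) ∧ ι.IsDecidable ∧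
        Φ ∈ N.app.E ∧ N.app.E = ι.E ∧
        ∀ {B : Type v} (L : PCA B) (γ : ApplicativeMorphism M L),
          γ.IsDecidable → Φ ∈ γ.E →
          ∃ γF : ApplicativeMorphism N L, γF.IsDecidable ∧ γF.comp ι = γ ∧
            (∀ δ : ApplicativeMorphism N L, δ.IsDecidable → δ.comp ι = γ → δ.Equivalent γF) ∧
            (∀ δ : ApplicativeMorphism N L, δ.IsDecidable → (δ.comp ι).Equivalent γ →
              δ.Equivalent γF) := by
  refine ⟨fun α β h a b => PCA.stage_mono h, ?_⟩
  obtain ⟨N, hN⟩ := M.exists_oraclePCA (M.stageUnion Φ)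
  obtain ⟨r, hr⟩ := M.exists_oracle_realizer (M.stageUnion Φ)
  rw [← hN] at hr
  let ι : ApplicativeMorphism M N := .ofRealizer (fun a => {a}) (fun a => ⟨a, rfl⟩) (by
    refine ⟨r, ?_⟩
    rintro _ _ c a a' hc rfl rfl
    obtain ⟨x, hx, h⟩ := hr a
    exact ⟨x, hx, c, h _ _ hc, rfl⟩)
  have hι : ∀ a, ι.rel a = {a} := fun a => rfl
  refine ⟨N, hN, ι, hι, ApplicativeMorphism.isDecidable_of_rel_eq_singleton hι, ?_,
    ApplicativeMorphism.E_eq_of_rel_eq_singleton hι, ?_⟩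
  · obtain ⟨a, ha⟩ := M.exists_oracle_index (M.stageUnion Φ)
    rw [← hN] at ha
    refine ⟨a, fun g hg y hy => (PAS.setDefined_and_setApp_eq_singleton_iff hg).2 fun e he => ?_⟩
    rw [hN] at hg he
    -- Closure of $f$ gives $f(e)=F(g)$, so the index of the oracle realizes $F$.
    exact ha _ _ (PCA.mem_stageUnion_of_stageRel ⟨g, hg, he, hy⟩)
  · intro B L γ hγ hΦ
    let γF : ApplicativeMorphism N L := .ofRealizer γ.rel γ.total (by
      rw [hN]
      exact ApplicativeMorphism.exists_realizer_stageUnion hγ hΦ)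
    have hcomp : ∀ (δ : ApplicativeMorphism N L) a, (δ.comp ι).rel a = δ.rel a := fun δ a => by
      simp [ApplicativeMorphism.comp, hι]
    have hγF : γF.comp ι = γ := ApplicativeMorphism.ext (funext fun a => hcomp γF a)
    have huniq : ∀ δ : ApplicativeMorphism N L, (δ.comp ι).Equivalent γ → δ.Equivalent γF := by
      intro δ h
      simp only [ApplicativeMorphism.Equivalent, ApplicativeMorphism.Le, hcomp] at h
      exact h
    have hrefl : γ.Le γ := ⟨L.I, fun a => PAS.setDefined_and_setApp_subset_iff.2 fun p hp =>
      ⟨p, L.I_app p, hp⟩⟩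
    refine ⟨γF, ApplicativeMorphism.isDecidable_of_comp hι (hγF ▸ hγ), hγF,
      fun δ _ h => huniq δ (by rw [h]; exact ⟨hrefl, hrefl⟩), fun δ _ h => huniq δ h⟩
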